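/- Theorem 1.4. Let $d \ge 1$ and let $\|\cdot\|_P$ be a polyhedral norm on $\mathbb{R}^d$, i.e. a norm whose closed unit ball is the intersection of finitely many closed half-spaces. Then for every $s \in [d-1,d]$ there exist a compact set $E \subseteq \mathbb{R}^d$ with $\dim_H E = s$ and a point $x \in E$ such that $$\dim_H \Delta_x^P(E) = s - (d-1), \qquad \text{where } \Delta_x^P(E) := \{\, \|x-y\|_P : y \in E \,\} \subseteq [0,\infty)$$ is the distance set of $E$ pinned at $x$. Here $\dim_H$ denotes Hausdorff dimension with respect to the Euclidean metric (on $\mathbb{R}^d$ and on $\mathbb{R}$). -/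

import Mathlib

/-- A (convex) polyhedron in `ℝ^d`: the intersection of finitely many closed half-spaces
`{x | ⟪v, x⟫ ≤ b}`. -/
def IsPolyhedron {d : ℕ} (S : Set (EuclideanSpace ℝ (Fin d))) : Prop :=
  ∃ (N : ℕ) (v : Fin N → EuclideanSpace ℝ (Fin d)) (b : Fin N → ℝ),
    S = {x | ∀ i, inner ℝ (v i) x ≤ b i}

/-- A polyhedral norm on `ℝ^d`: a norm (a seminorm vanishing only at the origin) whose closed unit
ball is a polyhedron. -/
structure IsPolyhedralNorm {d : ℕ} (P : Seminorm ℝ (EuclideanSpace ℝ (Fin d))) : Prop where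
  eq_zero_of_map_eq_zero : ∀ x, P x = 0 → x = 0
  isPolyhedron_unitBall : IsPolyhedron (P.closedBall 0 1)

/-- The pinned distance set `{P (x - y) : y ∈ E}` of `E` at `x`, for the norm `P`. -/
def pinnedDistanceSet {d : ℕ} (P : Seminorm ℝ (EuclideanSpace ℝ (Fin d)))
    (x : EuclideanSpace ℝ (Fin d)) (E : Set (EuclideanSpace ℝ (Fin d))) : Set ℝ :=
  {t | ∃ y ∈ E, t = P (x - y)}

open Set Filter Topology Metric MeasureTheory Measure
open scoped ENNReal NNReal

/-! A polyhedral norm is the maximum of finitely many linear functionals, so by Baire it equals a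
single nonzero functional `w` on some ball (`IsPolyhedralNorm.exists_eq_inner`). Put m = d - 1 and
place in that ball a small copy of A × [0,1]^m, with the A-axis along `w` and dim A = s - m, then
add the origin as pin. Distances from the origin see only the A-coordinate, so the distance set is
{0} together with an affine copy of A.

Hausdorff dimension need not add up over general products, so A is taken regular: efficient covers
at one common scale bound the measure of the product from above, and a map with Hölder inverse
bounds it from below (`dimH_prodCube`). -/

/-- A compact set of reals that is `α`-dimensional in a strong sense: it has economical covers by
intervals of a common small length, and it contains the image of `[0, 1]` under a measurable map
whose inverse is `α`-Hölder. -/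
structure IsRegularCompact (α : ℝ) (A : Set ℝ) : Prop where
  isCompact : IsCompact A
  cover : ∃ (C : ℝ) (r : ℕ → ℝ) (N : ℕ → ℕ) (t : ∀ n, Fin (N n) → ℝ), (∀ n, 0 < r n) ∧
    Tendsto r atTop (𝓝 0) ∧ (∀ n, A ⊆ ⋃ i, closedBall (t n i) (r n)) ∧ ∀ n, N n * r n ^ α ≤ C
  param : ∃ (C : ℝ) (g : ℝ → ℝ), 0 < C ∧ Measurable g ∧ (∀ x ∈ Icc (0 : ℝ) 1, g x ∈ A) ∧
    ∀ x ∈ Icc (0 : ℝ) 1, ∀ y ∈ Icc (0 : ℝ) 1, |x - y| ≤ C * |g x - g y| ^ α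

/-! ### Regular compact sets of every dimension in [0, 1] -/

theorem isRegularCompact_singleton : IsRegularCompact 0 {(0 : ℝ)} where
  isCompact := isCompact_singleton
  cover := by
    refine ⟨1, fun n => 1 / ((n : ℝ) + 1), fun _ => 1, fun _ _ => 0, fun n => by positivity,
      tendsto_one_div_add_atTop_nhds_zero_nat, fun n => ?_, fun n => by simp⟩
    rintro x rfl
    exact mem_iUnion.2 ⟨0, mem_closedBall_self (by positivity)⟩
  param := by
    refine ⟨1, fun _ => 0, one_pos, measurable_const, fun x _ => rfl, fun x hx y hy => ?_⟩
    simp only [Real.rpow_zero, mul_one, abs_le]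
    constructor <;> linarith [hx.1, hx.2, hy.1, hy.2]

/-- The unit interval is covered by `⌈r⁻¹⌉ + 1` intervals of radius `r`. -/
theorem Icc_subset_iUnion_closedBall {r : ℝ} (hr : 0 < r) :
    Icc (0 : ℝ) 1 ⊆ ⋃ i : Fin (⌈r⁻¹⌉₊ + 1), closedBall ((i : ℝ) * r) r := by
  intro x hx
  have h0 : 0 ≤ x / r := div_nonneg hx.1 hr.le
  have h1 : ⌊x / r⌋₊ < ⌈r⁻¹⌉₊ + 1 := by
    rw [Nat.lt_succ_iff]
    refine (Nat.floor_le_floor ?_).trans (Nat.floor_le_ceil _)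
    rw [div_eq_mul_inv]
    exact mul_le_of_le_one_left (inv_nonneg.2 hr.le) hx.2
  refine mem_iUnion.2 ⟨⟨_, h1⟩, ?_⟩
  have h2 := Nat.floor_le h0
  have h3 := (Nat.lt_floor_add_one (x / r)).le
  rw [le_div_iff₀ hr] at h2
  rw [div_le_iff₀ hr] at h3
  rw [mem_closedBall, Real.dist_eq, abs_le]
  constructor <;> simp only <;> linarith

theorem ceil_inv_add_one_le {r : ℝ} (hr : 0 < r) (hr1 : r ≤ 1) :
    ((⌈r⁻¹⌉₊ + 1 : ℕ) : ℝ) ≤ 3 / r := by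
  have h := Nat.ceil_lt_add_one (inv_nonneg.2 hr.le)
  have h1 : 1 ≤ r⁻¹ := (one_le_inv₀ hr).2 hr1
  push_cast
  rw [div_eq_mul_inv]
  linarith

theorem isRegularCompact_Icc : IsRegularCompact 1 (Icc 0 1) where
  isCompact := isCompact_Icc
  cover := by
    refine ⟨3, fun n => 1 / ((n : ℝ) + 1), fun n => ⌈(1 / ((n : ℝ) + 1))⁻¹⌉₊ + 1,
      fun n i => i * (1 / ((n : ℝ) + 1)), fun n => by positivity,
      tendsto_one_div_add_atTop_nhds_zero_nat,
      fun n => Icc_subset_iUnion_closedBall (by positivity), fun n => ?_⟩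
    have h0 : (0 : ℝ) < 1 / ((n : ℝ) + 1) := by positivity
    have h1 : 1 / ((n : ℝ) + 1) ≤ 1 := by
      rw [div_le_one (by positivity)]
      linarith [n.cast_nonneg (α := ℝ)]
    have := mul_le_mul_of_nonneg_right (ceil_inv_add_one_le h0 h1) h0.le
    rw [div_mul_cancel₀ _ h0.ne'] at this
    simpa only [Real.rpow_one] using this
  param := ⟨1, id, one_pos, measurable_id, fun x hx => hx, fun x _ y _ => by simp⟩

/-- A strictly increasing function jumping by at least `l ^ n` at every multiple of `2⁻ⁿ`; the
closure of its range is a Cantor set of dissection ratio `l`. -/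
noncomputable def cantorJump (l x : ℝ) : ℝ := ∑' n : ℕ, l ^ n * (⌊2 ^ n * x⌋₊ : ℝ)

section CantorJump

variable {l : ℝ}

theorem summable_cantorJump (hl : 0 < l) (hl2 : l < 1 / 2) (x : ℝ) :
    Summable fun n : ℕ => l ^ n * (⌊2 ^ n * x⌋₊ : ℝ) := by
  have hg : Summable fun n : ℕ => (2 * l) ^ n * |x| :=
    (summable_geometric_of_lt_one (by positivity) (by linarith)).mul_right _
  refine Summable.of_nonneg_of_le (fun n => by positivity) (fun n => ?_) hg
  have h : (⌊2 ^ n * x⌋₊ : ℝ) ≤ 2 ^ n * |x| :=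
    (Nat.cast_le.2 (Nat.floor_le_floor (by gcongr; exact le_abs_self x))).trans
      (Nat.floor_le (by positivity))
  calc l ^ n * (⌊2 ^ n * x⌋₊ : ℝ) ≤ l ^ n * (2 ^ n * |x|) := by gcongr
    _ = (2 * l) ^ n * |x| := by rw [mul_pow]; ring

theorem monotone_cantorJump (hl : 0 < l) (hl2 : l < 1 / 2) : Monotone (cantorJump l) := by
  intro x y hxy
  refine (summable_cantorJump hl hl2 x).tsum_le_tsum (fun n => ?_) (summable_cantorJump hl hl2 y)
  gcongr

/-- The `n`-th term alone gives the gap, since its floor grows by at least one; all other terms are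
nondecreasing. -/
theorem pow_le_cantorJump_sub (hl : 0 < l) (hl2 : l < 1 / 2) {x y : ℝ} (hx : 0 ≤ x) {n : ℕ}
    (hxy : (1 / 2) ^ n ≤ y - x) : l ^ n ≤ cantorJump l y - cantorJump l x := by
  have hsx := summable_cantorJump hl hl2 x
  have hsy := summable_cantorJump hl hl2 y
  have hle : x ≤ y := by
    have : (0 : ℝ) < (1 / 2) ^ n := by positivity
    linarith
  rw [cantorJump, cantorJump, ← hsy.tsum_sub hsx]
  refine le_trans ?_ ((hsy.sub hsx).le_tsum n fun j _ => ?_)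
  · rw [← mul_sub]
    refine le_mul_of_one_le_right (by positivity) ?_
    have h1 : 2 ^ n * x + 1 ≤ 2 ^ n * y := by
      have := mul_le_mul_of_nonneg_left hxy (show (0 : ℝ) ≤ 2 ^ n by positivity)
      rw [← mul_pow] at this
      norm_num at this
      linarith
    have h2 : ⌊2 ^ n * x⌋₊ + 1 ≤ ⌊2 ^ n * y⌋₊ := by
      rw [← Nat.floor_add_one (by positivity)]
      exact Nat.floor_le_floor h1
    have h3 : ((⌊2 ^ n * x⌋₊ : ℝ) + 1) ≤ ⌊2 ^ n * y⌋₊ := by exact_mod_cast h2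
    linarith
  · rw [← mul_sub]
    refine mul_nonneg (by positivity) (sub_nonneg.2 ?_)
    gcongr

/-- The first `n` terms agree at `x` and at the dyadic point to its left; the tail is dominated by a
geometric series of ratio `2 * l`. -/
theorem cantorJump_sub_floor_le (hl : 0 < l) (hl2 : l < 1 / 2) {x : ℝ} (hx : 0 ≤ x) (n : ℕ) :
    |cantorJump l x - cantorJump l (⌊2 ^ n * x⌋₊ / 2 ^ n)| ≤ 2 / (1 - 2 * l) * l ^ n := by
  set k := ⌊2 ^ n * x⌋₊ with hk
  have hkx : (k : ℝ) ≤ 2 ^ n * x := Nat.floor_le (by positivity)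
  have hxk : 2 ^ n * x < k + 1 := Nat.lt_floor_add_one _
  have hle : (k : ℝ) / 2 ^ n ≤ x := by rw [div_le_iff₀ (by positivity)]; linarith
  have hsx := summable_cantorJump hl hl2 x
  have hsy := summable_cantorJump hl hl2 (k / 2 ^ n)
  rw [abs_of_nonneg (sub_nonneg.2 (monotone_cantorJump hl hl2 hle)), cantorJump, cantorJump,
    ← hsx.tsum_sub hsy, ← (hsx.sub hsy).sum_add_tsum_nat_add n]
  have hzero : ∑ i ∈ Finset.range n,
      (l ^ i * (⌊2 ^ i * x⌋₊ : ℝ) - l ^ i * (⌊2 ^ i * (k / 2 ^ n : ℝ)⌋₊ : ℝ)) = 0 := by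
    refine Finset.sum_eq_zero fun i hi => ?_
    rw [Finset.mem_range] at hi
    have : ⌊2 ^ i * x⌋₊ = ⌊2 ^ i * (k / 2 ^ n : ℝ)⌋₊ := by
      refine le_antisymm (Nat.le_floor ?_) (Nat.floor_le_floor (by gcongr))
      have h1 : (⌊2 ^ i * x⌋₊ : ℝ) ≤ 2 ^ i * x := Nat.floor_le (by positivity)
      have hn : (2 : ℝ) ^ n = 2 ^ (n - i) * 2 ^ i := by rw [← pow_add]; congr 1; omega
      have h2 : 2 ^ (n - i) * ⌊2 ^ i * x⌋₊ ≤ k := by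
        refine Nat.le_floor ?_
        push_cast
        rw [hn, mul_assoc]
        gcongr
      have h3 : (2 : ℝ) ^ (n - i) * ⌊2 ^ i * x⌋₊ ≤ k := by exact_mod_cast h2
      rw [hn, mul_div_assoc', le_div_iff₀ (by positivity)]
      nlinarith [pow_pos (two_pos : (0 : ℝ) < 2) i]
    rw [this, sub_self]
  rw [hzero, zero_add]
  have hgeo : HasSum (fun j : ℕ => 2 * l ^ n * (2 * l) ^ j) (2 * l ^ n * (1 - 2 * l)⁻¹) :=
    (hasSum_geometric_of_lt_one (by positivity) (by linarith)).mul_left _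
  have hs := (summable_nat_add_iff n).2 (hsx.sub hsy)
  refine (hs.tsum_le_tsum (fun j => ?_) hgeo.summable).trans ?_
  · rw [← mul_sub]
    have h1 : (⌊2 ^ (j + n) * x⌋₊ : ℝ) ≤ 2 ^ (j + n) * x := Nat.floor_le (by positivity)
    have h2 := Nat.lt_floor_add_one (2 ^ (j + n) * (k / 2 ^ n : ℝ))
    have h3 : 2 ^ (j + n) * (k / 2 ^ n : ℝ) = 2 ^ j * k := by
      rw [pow_add]; field_simp
    have h4 : (1 : ℝ) ≤ 2 ^ j := one_le_pow₀ (by norm_num)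
    have h5 : (2 : ℝ) ^ (j + n) * x ≤ 2 ^ j * (k + 1) := by
      rw [pow_add, mul_assoc]
      gcongr
    calc l ^ (j + n) * ((⌊2 ^ (j + n) * x⌋₊ : ℝ) - ⌊2 ^ (j + n) * (k / 2 ^ n : ℝ)⌋₊)
        ≤ l ^ (j + n) * (2 * 2 ^ j) := by
          gcongr
          linarith
      _ = 2 * l ^ n * (2 * l) ^ j := by rw [mul_pow, pow_add]; ring
  · rw [hgeo.tsum_eq]
    exact le_of_eq (by ring)

theorem isRegularCompact_closure_cantorJump {α : ℝ} (h0 : 0 < α) (hl : 0 < l) (hl2 : l < 1 / 2)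
    (hα : l ^ α = 1 / 2) : IsRegularCompact α (closure (cantorJump l '' Icc 0 1)) := by
  have hmono := monotone_cantorJump hl hl2
  have hpow (n : ℕ) : (l ^ n) ^ α = (1 / 2) ^ n := by
    rw [← Real.rpow_natCast, ← Real.rpow_mul hl.le, mul_comm, Real.rpow_mul hl.le, hα,
      Real.rpow_natCast]
  refine ⟨?_, ?_, ?_⟩
  · have hb : Bornology.IsBounded (cantorJump l '' Icc 0 1) := by
      refine (isBounded_Icc (cantorJump l 0) (cantorJump l 1)).subset ?_
      rintro _ ⟨x, hx, rfl⟩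
      exact ⟨hmono hx.1, hmono hx.2⟩
    exact hb.isCompact_closure
  · set D := 2 / (1 - 2 * l) with hD
    have hD0 : 0 < D := div_pos two_pos (by linarith)
    refine ⟨2 * D ^ α, fun n => D * l ^ n, fun n => 2 ^ n + 1,
      fun n i => cantorJump l (i / 2 ^ n), fun n => by positivity, ?_, fun n => ?_, fun n => ?_⟩
    · simpa using (tendsto_pow_atTop_nhds_zero_of_lt_one hl.le (by linarith)).const_mul D
    · refine closure_minimal ?_ (isClosed_iUnion_of_finite fun _ => isClosed_closedBall)
      rintro _ ⟨x, hx, rfl⟩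
      -- The endpoint `x = 1` has index `2 ^ n`, hence the extra centre.
      have h1 : ⌊2 ^ n * x⌋₊ < 2 ^ n + 1 := by
        rw [Nat.lt_succ_iff]
        refine Nat.floor_le_of_le ?_
        push_cast
        exact mul_le_of_le_one_right (by positivity) hx.2
      refine mem_iUnion.2 ⟨⟨_, h1⟩, ?_⟩
      rw [mem_closedBall, Real.dist_eq]
      exact cantorJump_sub_floor_le hl hl2 hx.1 n
    · rw [Real.mul_rpow hD0.le (by positivity), hpow]
      have h1 : ((2 ^ n + 1 : ℕ) : ℝ) ≤ 2 * 2 ^ n := by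
        push_cast
        linarith [one_le_pow₀ (M₀ := ℝ) (n := n) one_le_two]
      calc ((2 ^ n + 1 : ℕ) : ℝ) * (D ^ α * (1 / 2) ^ n) ≤ 2 * 2 ^ n * (D ^ α * (1 / 2) ^ n) := by
            gcongr
        _ = 2 * D ^ α * (2 * (1 / 2)) ^ n := by rw [mul_pow]; ring
        _ = 2 * D ^ α := by norm_num
  · refine ⟨2, cantorJump l, two_pos, hmono.measurable,
      fun x hx => subset_closure (mem_image_of_mem _ hx), ?_⟩
    have key : ∀ x ∈ Icc (0 : ℝ) 1, ∀ y ∈ Icc (0 : ℝ) 1, x < y →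
        |x - y| ≤ 2 * |cantorJump l x - cantorJump l y| ^ α := by
      intro x hx y hy hxy
      obtain ⟨n, hn1, hn2⟩ := exists_nat_pow_near_of_lt_one (x := y - x) (y := 1 / 2)
        (by linarith) (by linarith [hx.1, hy.2]) (by norm_num) (by norm_num)
      have h := pow_le_cantorJump_sub hl hl2 hx.1 hn1.le
      rw [abs_sub_comm, abs_of_pos (sub_pos.2 hxy), abs_sub_comm]
      calc y - x ≤ (1 / 2) ^ n := hn2
        _ = 2 * (l ^ (n + 1)) ^ α := by rw [hpow, pow_succ]; ring
        _ ≤ 2 * |cantorJump l y - cantorJump l x| ^ α := by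
          gcongr
          exact h.trans (le_abs_self _)
    intro x hx y hy
    rcases lt_trichotomy x y with h | rfl | h
    · exact key x hx y hy h
    · simp [Real.zero_rpow h0.ne']
    · rw [abs_sub_comm x, abs_sub_comm (cantorJump l x)]
      exact key y hy x hx h

end CantorJump

theorem exists_isRegularCompact {α : ℝ} (hα : α ∈ Icc (0 : ℝ) 1) :
    ∃ A, IsRegularCompact α A := by
  rcases hα.1.eq_or_lt with rfl | h0
  · exact ⟨_, isRegularCompact_singleton⟩
  rcases hα.2.eq_or_lt with rfl | h1
  · exact ⟨_, isRegularCompact_Icc⟩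
  -- This ratio solves `l ^ α = 1 / 2`, and `α < 1` forces `l < 1 / 2`.
  have hl : (0 : ℝ) < (1 / 2) ^ (1 / α) := by positivity
  refine ⟨_, isRegularCompact_closure_cantorJump (l := (1 / 2) ^ (1 / α)) h0 hl ?_ ?_⟩
  · have := Real.rpow_lt_rpow_of_exponent_gt (x := 1 / 2) (by norm_num) (by norm_num)
      ((one_lt_div h0).2 h1)
    rwa [Real.rpow_one] at this
  · rw [← Real.rpow_mul (by norm_num), one_div_mul_cancel h0.ne', Real.rpow_one]

/-! ### Hausdorff dimension of the product with a cube -/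

/-- The product of `A` in the first coordinate with a unit cube in the others. -/
def prodCube (m : ℕ) (A : Set ℝ) : Set (Fin (m + 1) → ℝ) :=
  {y | y 0 ∈ A ∧ ∀ j : Fin m, y j.succ ∈ Icc (0 : ℝ) 1}

theorem IsCompact.prodCube {A : Set ℝ} (hA : IsCompact A) (m : ℕ) : IsCompact (prodCube m A) := by
  have h : IsCompact (univ.pi (Fin.cons A fun _ => Icc (0 : ℝ) 1 : Fin (m + 1) → Set ℝ)) := by
    refine isCompact_univ_pi fun i => ?_
    refine Fin.cases ?_ (fun j => ?_) i
    · simpa using hA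
    · simpa using isCompact_Icc
  convert h using 1
  ext y
  simp only [_root_.prodCube, mem_ofPred_eq, mem_univ_pi, Fin.forall_fin_succ, Fin.cons_zero,
    Fin.cons_succ]

theorem ediam_closedBall_le_ofReal {X : Type*} [PseudoMetricSpace X] (r : ℝ) (x : X) :
    ediam (closedBall x r) ≤ ENNReal.ofReal (2 * r) :=
  ediam_le_of_forall_dist_le fun _ ha _ hb =>
    (dist_triangle_right _ _ x).trans (by linarith [mem_closedBall.1 ha, mem_closedBall.1 hb])

/-- In the sup metric, products of intervals of radius `r` are balls; about `r ^ (-α) * r ^ (-m)` of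
them suffice. -/
theorem hausdorffMeasure_prodCube_ne_top {α : ℝ} {A : Set ℝ} (hα : 0 ≤ α)
    (hA : IsRegularCompact α A) (m : ℕ) : μH[α + m] (prodCube m A) ≠ ∞ := by
  obtain ⟨C, r, N, t, hr, hr0, hcov, hN⟩ := hA.cover
  have hfin : ∀ᶠ n in atTop, ∑ _i : Fin (N n) × (Fin m → Fin (⌈(r n)⁻¹⌉₊ + 1)),
      ENNReal.ofReal (2 * r n) ^ (α + m) ≤ ENNReal.ofReal (C * 3 ^ m * 2 ^ (α + m)) := by
    filter_upwards [hr0.eventually_le_const one_pos] with n hn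
    have hrn := hr n
    rw [Finset.sum_const, Finset.card_univ, Fintype.card_prod, Fintype.card_fun, Fintype.card_fin,
      Fintype.card_fin, Fintype.card_fin, nsmul_eq_mul,
      ENNReal.ofReal_rpow_of_nonneg (by positivity) (by positivity), ← ENNReal.ofReal_natCast,
      ← ENNReal.ofReal_mul (by positivity)]
    refine ENNReal.ofReal_le_ofReal ?_
    rw [Real.mul_rpow two_pos.le hrn.le, Real.rpow_add hrn, Real.rpow_natCast]
    have hK := ceil_inv_add_one_le hrn hn
    push_cast at hK ⊢
    calc (N n : ℝ) * (⌈(r n)⁻¹⌉₊ + 1) ^ m * (2 ^ (α + m) * (r n ^ α * r n ^ m))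
        ≤ (N n : ℝ) * (3 / r n) ^ m * (2 ^ (α + m) * (r n ^ α * r n ^ m)) := by gcongr
      _ = (N n * r n ^ α) * 3 ^ m * 2 ^ (α + m) := by rw [div_pow]; field_simp
      _ ≤ C * 3 ^ m * 2 ^ (α + m) := by
        gcongr
        exact hN n
  have hle := hausdorffMeasure_le_liminf_sum (α + m) (prodCube m A) (l := atTop)
    (ι := fun n => Fin (N n) × (Fin m → Fin (⌈(r n)⁻¹⌉₊ + 1)))
    (fun n => ENNReal.ofReal (2 * r n)) (by
      have := (hr0.const_mul 2)
      rw [mul_zero] at this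
      simpa using ENNReal.tendsto_ofReal this)
    (fun n i => closedBall (Fin.cons (t n i.1) fun j => (i.2 j : ℝ) * r n) (r n))
    (Eventually.of_forall fun n i => by
      exact ediam_closedBall_le_ofReal _ _)
    (Eventually.of_forall fun n y hy => by
      obtain ⟨i, hi⟩ := mem_iUnion.1 (hcov n hy.1)
      have (j : Fin m) := mem_iUnion.1 (Icc_subset_iUnion_closedBall (hr n) (hy.2 j))
      choose k hk using this
      refine mem_iUnion.2 ⟨(i, k), ?_⟩
      rw [mem_closedBall, dist_pi_le_iff (hr n).le, Fin.forall_fin_succ]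
      exact ⟨by simpa using hi, fun j => by simpa using hk j⟩)
  refine ne_top_of_le_ne_top (ENNReal.ofReal_ne_top (r := C * 3 ^ m * 2 ^ (α + m)))
    (hle.trans ?_)
  refine (liminf_le_liminf (?_ : _ ≤ᶠ[atTop] fun _ =>
    ENNReal.ofReal (C * 3 ^ m * 2 ^ (α + m)))).trans (liminf_const _).le
  filter_upwards [hfin] with n hn
  refine le_trans (Finset.sum_le_sum fun i _ => ?_) hn
  exact ENNReal.rpow_le_rpow (ediam_closedBall_le_ofReal _ _) (by positivity)

/-- Mass distribution principle for the image `ν` of Lebesgue measure on the cube under `g` × id.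
The preimage of a set of diameter δ has width at most C δ^α in the first coordinate and δ in the
others. -/
theorem hausdorffMeasure_prodCube_ne_zero {α : ℝ} {A : Set ℝ} (hα : 0 ≤ α)
    (hA : IsRegularCompact α A) (m : ℕ) : μH[α + m] (prodCube m A) ≠ 0 := by
  obtain ⟨C, g, hC, hg, hgA, hgC⟩ := hA.param
  let cube : Set (Fin (m + 1) → ℝ) := univ.pi fun _ => Icc 0 1
  let G : (Fin (m + 1) → ℝ) → Fin (m + 1) → ℝ := fun y => Fin.cons (g (y 0)) fun j => y j.succ
  have hG : Measurable G := by
    refine measurable_pi_iff.2 fun i => ?_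
    refine Fin.cases ?_ (fun j => ?_) i
    · exact hg.comp (measurable_pi_apply 0)
    · exact measurable_pi_apply j.succ
  let ν := (volume.restrict cube).map G
  have hνS (S : Set (Fin (m + 1) → ℝ)) : ν S ≤ ENNReal.ofReal C * ediam S ^ (α + m) := by
    -- Closing `S` makes it measurable and keeps its diameter.
    rw [← Metric.ediam_closure S]
    refine (measure_mono subset_closure).trans ?_
    rw [map_apply hG isClosed_closure.measurableSet,
      restrict_apply (hG isClosed_closure.measurableSet)]
    refine (Real.volume_pi_le_prod_diam _).trans ?_
    rw [Fin.prod_univ_succ, ENNReal.rpow_add_of_nonneg _ _ hα m.cast_nonneg, ENNReal.rpow_natCast,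
      ← mul_assoc]
    refine mul_le_mul' (Metric.ediam_le ?_) ?_
    · rintro _ ⟨x, ⟨hxS, hxc⟩, rfl⟩ _ ⟨y, ⟨hyS, hyc⟩, rfl⟩
      have h1 := hgC (x 0) (hxc 0 trivial) (y 0) (hyc 0 trivial)
      have h2 : edist (g (x 0)) (g (y 0)) ≤ ediam (closure S) :=
        (edist_le_pi_edist (G x) (G y) 0).trans (Metric.edist_le_ediam_of_mem hxS hyS)
      calc edist (x 0) (y 0) = ENNReal.ofReal |x 0 - y 0| := by rw [edist_dist, Real.dist_eq]
        _ ≤ ENNReal.ofReal (C * |g (x 0) - g (y 0)| ^ α) := ENNReal.ofReal_le_ofReal h1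
        _ = ENNReal.ofReal C * edist (g (x 0)) (g (y 0)) ^ α := by
          rw [ENNReal.ofReal_mul hC.le, edist_dist, Real.dist_eq,
            ENNReal.ofReal_rpow_of_nonneg (abs_nonneg _) hα]
        _ ≤ ENNReal.ofReal C * ediam (closure S) ^ α := by gcongr
    · refine (Finset.prod_le_pow_card _ _ (ediam (closure S)) fun j _ => ?_).trans (by simp)
      refine Metric.ediam_le ?_
      rintro _ ⟨x, ⟨hxS, -⟩, rfl⟩ _ ⟨y, ⟨hyS, -⟩, rfl⟩
      exact (edist_le_pi_edist (G x) (G y) j.succ).trans (Metric.edist_le_ediam_of_mem hxS hyS)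
  have hC0 : ENNReal.ofReal C ≠ 0 := by simpa using hC
  have hle : (ENNReal.ofReal C)⁻¹ • ν ≤ μH[α + m] := by
    refine le_hausdorffMeasure _ _ 1 one_pos fun S _ => ?_
    rw [Measure.smul_apply, smul_eq_mul, ENNReal.inv_mul_le_iff hC0 ENNReal.ofReal_ne_top]
    exact hνS S
  have hν1 : 1 ≤ ν (prodCube m A) := by
    refine le_trans ?_ (le_map_apply hG.aemeasurable _)
    refine le_trans ?_ (le_restrict_apply _ _)
    have hsub : cube ⊆ G ⁻¹' prodCube m A ∩ cube := fun y hy =>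
      ⟨⟨by simpa [G] using hgA _ (hy 0 trivial), fun j => by simpa [G] using hy j.succ trivial⟩, hy⟩
    refine le_trans ?_ (measure_mono hsub)
    rw [volume_pi_pi]
    simp
  have h := hle (prodCube m A)
  rw [Measure.smul_apply, smul_eq_mul] at h
  refine (lt_of_lt_of_le ?_ h).ne'
  exact ENNReal.mul_pos (ENNReal.inv_ne_zero.2 ENNReal.ofReal_ne_top)
    (lt_of_lt_of_le one_pos hν1).ne'

theorem dimH_prodCube {α : ℝ} {A : Set ℝ} (hα : 0 ≤ α) (hA : IsRegularCompact α A) (m : ℕ) :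
    dimH (prodCube m A) = ENNReal.ofReal (α + m) := by
  have h : ((α + m).toNNReal : ℝ) = α + m := Real.coe_toNNReal _ (by positivity)
  refine dimH_of_hausdorffMeasure_ne_zero_ne_top (d := (α + m).toNNReal) ?_ ?_
  · rw [h]; exact hausdorffMeasure_prodCube_ne_zero hα hA m
  · rw [h]; exact hausdorffMeasure_prodCube_ne_top hα hA m

theorem dimH_eq_of_isRegularCompact {α : ℝ} {A : Set ℝ} (hα : 0 ≤ α)
    (hA : IsRegularCompact α A) : dimH A = ENNReal.ofReal α := by
  have h := dimH_prodCube hα hA 0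
  rw [Nat.cast_zero, add_zero] at h
  rw [← h, ← (IsometryEquiv.funUnique (Fin 1) ℝ).symm.dimH_image]
  congr 1
  ext y
  simp only [prodCube, mem_image, mem_ofPred_eq, IsEmpty.forall_iff, and_true]
  refine ⟨?_, fun hy => ⟨y 0, hy, ?_⟩⟩
  · rintro ⟨x, hx, rfl⟩
    exact hx
  · exact (IsometryEquiv.funUnique (Fin 1) ℝ).symm_apply_apply y

/-! ### Linear pieces of the norm and changes of coordinates -/

/-- A polyhedral norm on a nontrivial space agrees with a nonzero linear functional on some ball. -/
theorem IsPolyhedralNorm.exists_eq_inner {d : ℕ} (hd : 1 ≤ d)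
    {P : Seminorm ℝ (EuclideanSpace ℝ (Fin d))} (hP : IsPolyhedralNorm P) :
    ∃ w : EuclideanSpace ℝ (Fin d), w ≠ 0 ∧ ∃ p, ∃ ε > 0, ∀ y ∈ ball p ε, P y = inner ℝ w y := by
  obtain ⟨N, v, b, hS⟩ := hP.isPolyhedron_unitBall
  have hunit (x) : P x ≤ 1 ↔ ∀ i, inner ℝ (v i) x ≤ b i := by
    rw [← P.mem_closedBall_zero, hS]; rfl
  have hb0 (i) : 0 ≤ b i := by
    have := (hunit 0).1 (by simp) i
    simpa using this
  -- A small positive multiple of `v i` lies in the unit ball and pairs positively with `v i`.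
  have hb (i) (hi : v i ≠ 0) : 0 < b i := by
    have hc : 0 < P (v i) + 1 := by linarith [apply_nonneg P (v i)]
    have h := (hunit ((P (v i) + 1)⁻¹ • v i)).1 (by
      rw [map_smul_eq_mul, Real.norm_of_nonneg (by positivity), inv_mul_le_one₀ hc]
      linarith) i
    rw [real_inner_smul_right, real_inner_self_eq_norm_sq] at h
    have : 0 < ‖v i‖ := norm_pos_iff.2 hi
    exact lt_of_lt_of_le (by positivity) h
  let w : {i // v i ≠ 0} → EuclideanSpace ℝ (Fin d) := fun i => (b i)⁻¹ • v i
  have hle {x} {t : ℝ} (ht : 0 < t) : P x ≤ t ↔ ∀ i, inner ℝ (w i) x ≤ t := by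
    have h1 : P x ≤ t ↔ P (t⁻¹ • x) ≤ 1 := by
      rw [map_smul_eq_mul, Real.norm_of_nonneg (by positivity), inv_mul_le_one₀ ht]
    rw [h1, hunit]
    have h2 (i) (hi : v i ≠ 0) :
        inner ℝ (v i) (t⁻¹ • x) ≤ b i ↔ inner ℝ (w ⟨i, hi⟩) x ≤ t := by
      simp only [w, real_inner_smul_left, real_inner_smul_right]
      rw [inv_mul_le_iff₀ ht, inv_mul_le_iff₀ (hb i hi), mul_comm]
    constructor
    · exact fun h i => (h2 i i.2).1 (h i)
    · intro h i
      by_cases hi : v i = 0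
      · simpa [hi] using hb0 i
      · exact (h2 i hi).2 (h ⟨i, hi⟩)
  have hzero {x} (hx : ¬ 0 < P x) : x = 0 :=
    hP.eq_zero_of_map_eq_zero x (le_antisymm (not_lt.1 hx) (apply_nonneg P x))
  have hinner_le (i x) : inner ℝ (w i) x ≤ P x := by
    by_cases hx : 0 < P x
    · exact (hle hx).1 le_rfl i
    · simp [hzero hx]
  have : Nonempty (Fin d) := ⟨⟨0, hd⟩⟩
  -- With no effective constraint, the norm would be at most every `t > 0`.
  have : Nonempty {i // v i ≠ 0} := by
    by_contra hI
    rw [not_nonempty_iff] at hI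
    obtain ⟨x, hx⟩ := exists_ne (0 : EuclideanSpace ℝ (Fin d))
    refine hx (hzero fun h => ?_)
    have := (hle (x := x) (half_pos h)).2 fun i => isEmptyElim i
    linarith
  have hmax {i x} (h : ∀ j, inner ℝ (w j) x ≤ inner ℝ (w i) x) : P x = inner ℝ (w i) x := by
    refine le_antisymm ?_ (hinner_le i x)
    by_cases hx : 0 < P x
    · by_contra! hlt
      -- `hle` needs a positive radius, hence the maximum with `0` and the midpoint of `M` and `P
      -- x`.
      set M := max (inner ℝ (w i) x) 0
      have hM : M < P x := max_lt hlt hx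
      have hM0 : 0 ≤ M := le_max_right _ _
      have := (hle (x := x) (t := (M + P x) / 2) (by linarith)).2 fun j => by
        linarith [h j, le_max_left (inner ℝ (w i) x) 0]
      linarith
    · simp [hzero hx]
  -- Baire: the finitely many closed regions where a given functional is maximal cover the space.
  obtain ⟨i, p, hp⟩ := nonempty_interior_of_iUnion_of_closed
    (f := fun i => {x | ∀ j, inner ℝ (w j) x ≤ inner ℝ (w i) x})
    (fun i => by
      simp only [ofPred_forall]
      exact isClosed_iInter fun j => isClosed_le (by fun_prop) (by fun_prop))
    (eq_univ_of_forall fun x => by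
      obtain ⟨i, hi⟩ := Finite.exists_max fun i => inner ℝ (w i) x
      exact mem_iUnion.2 ⟨i, hi⟩)
  obtain ⟨ε, hε, hball⟩ := Metric.isOpen_iff.1 isOpen_interior p hp
  exact ⟨w i, smul_ne_zero (inv_ne_zero (hb i i.2).ne') i.2, p, ε, hε,
    fun y hy => hmax (interior_subset (hball hy))⟩

/-- Every nonzero functional becomes a multiple of the first coordinate in suitable coordinates. -/
theorem exists_continuousLinearEquiv_inner_eq {m : ℕ} {w : EuclideanSpace ℝ (Fin (m + 1))}
    (hw : w ≠ 0) : ∃ L : (Fin (m + 1) → ℝ) ≃L[ℝ] EuclideanSpace ℝ (Fin (m + 1)),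
      ∀ z, inner ℝ w (L z) = ‖w‖ * z 0 := by
  have hw' : 0 < ‖w‖ := norm_pos_iff.2 hw
  -- The normalized `w` is extended to an orthonormal basis as its vector of index `0`.
  have hon : Orthonormal ℝ (({0} : Set (Fin (m + 1))).domRestrict fun _ => ‖w‖⁻¹ • w) := by
    rw [orthonormal_iff_ite]
    rintro ⟨i, rfl⟩ ⟨j, rfl⟩
    simp [norm_smul, hw'.ne']
  obtain ⟨b, hb⟩ := hon.exists_orthonormalBasis_extension_of_card_eq (by simp)
  refine ⟨(EuclideanSpace.equiv (Fin (m + 1)) ℝ).symm.trans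
    b.repr.symm.toContinuousLinearEquiv, fun z => ?_⟩
  have hw0 : w = ‖w‖ • b 0 := by
    rw [hb 0 rfl, smul_smul, mul_inv_cancel₀ hw'.ne', one_smul]
  have h := b.repr_apply_apply (b.repr.symm ((EuclideanSpace.equiv (Fin (m + 1)) ℝ).symm z)) 0
  rw [LinearIsometryEquiv.apply_symm_apply] at h
  conv_lhs => rw [hw0]
  rw [real_inner_smul_left]
  congr 1
  exact h.symm

/-- Used to carry the sup-metric product into Euclidean space, and `A` to its affine copy. -/
theorem dimH_image_add_continuousLinearEquiv {E F : Type*} [NormedAddCommGroup E]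
    [NormedSpace ℝ E] [NormedAddCommGroup F] [NormedSpace ℝ F] (L : E ≃L[ℝ] F) {δ : ℝ}
    (hδ : δ ≠ 0) (p : F) (S : Set E) : dimH ((fun z => p + δ • L z) '' S) = dimH S := by
  have h : (fun z => p + δ • L z) =
      IsometryEquiv.addLeft p ∘ (L.trans (ContinuousLinearEquiv.smulLeft (Units.mk0 δ hδ))) := rfl
  rw [h, image_comp, IsometryEquiv.dimH_image, ContinuousLinearEquiv.dimH_image]

theorem dimH_insert {X : Type*} [EMetricSpace X] (x : X) (S : Set X) :
    dimH (insert x S) = dimH S := by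
  rw [insert_eq, dimH_union, dimH_singleton, max_eq_right zero_le]

theorem theorem1p4 (d : ℕ) (hd : 1 ≤ d) (P : Seminorm ℝ (EuclideanSpace ℝ (Fin d)))
    (hP : IsPolyhedralNorm P) (s : ℝ) (hs : s ∈ Set.Icc ((d : ℝ) - 1) (d : ℝ)) :
    ∃ E : Set (EuclideanSpace ℝ (Fin d)), IsCompact E ∧ dimH E = ENNReal.ofReal s ∧
      ∃ x ∈ E, dimH (pinnedDistanceSet P x E) = ENNReal.ofReal (s - ((d : ℝ) - 1)) := by
  obtain ⟨w, hw, p, ε, hε, hPw⟩ := hP.exists_eq_inner hd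
  obtain ⟨m, rfl⟩ : ∃ m, d = m + 1 := ⟨d - 1, by omega⟩
  obtain ⟨L, hL⟩ := exists_continuousLinearEquiv_inner_eq hw
  push_cast at hs
  have hα : s - m ∈ Icc (0 : ℝ) 1 := ⟨by linarith [hs.1], by linarith [hs.2]⟩
  obtain ⟨A, hA⟩ := exists_isRegularCompact hα
  have hQ := hA.isCompact.prodCube m
  obtain ⟨R, hR0, hR⟩ := (hQ.image L.continuous).isBounded.exists_pos_norm_le
  have hδ : 0 < ε / (2 * R) := by positivity
  -- This scale puts the whole copy within `ε / 2` of `p`, where the norm is linear.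
  set δ := ε / (2 * R) with hδdef
  have hball : ∀ z ∈ prodCube m A, p + δ • L z ∈ ball p ε := by
    intro z hz
    rw [mem_ball, dist_eq_norm, add_sub_cancel_left, norm_smul, Real.norm_of_nonneg hδ.le]
    calc δ * ‖L z‖ ≤ δ * R := by gcongr; exact hR _ (mem_image_of_mem _ hz)
      _ = ε / 2 := by rw [hδdef]; field_simp
      _ < ε := half_lt_self hε
  refine ⟨insert 0 ((fun z => p + δ • L z) '' prodCube m A),
    (hQ.image (by fun_prop)).insert 0, ?_, 0, mem_insert _ _, ?_⟩
  · rw [dimH_insert, dimH_image_add_continuousLinearEquiv L hδ.ne', dimH_prodCube hα.1 hA,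
      sub_add_cancel]
  · have hc : δ * ‖w‖ ≠ 0 := mul_ne_zero hδ.ne' (norm_ne_zero_iff.2 hw)
    have hset : pinnedDistanceSet P 0 (insert 0 ((fun z => p + δ • L z) '' prodCube m A)) =
        insert 0 ((fun a => inner ℝ w p + (δ * ‖w‖) • ContinuousLinearEquiv.refl ℝ ℝ a) '' A) := by
      have hval : ∀ z ∈ prodCube m A,
          P (0 - (p + δ • L z)) = inner ℝ w p + (δ * ‖w‖) * z 0 := by
        intro z hz
        rw [zero_sub, map_neg_eq_map, hPw _ (hball z hz), inner_add_right, real_inner_smul_right,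
          hL, mul_assoc]
      ext t
      constructor
      · rintro ⟨y, rfl | ⟨z, hz, rfl⟩, rfl⟩
        · left; simp
        · exact Or.inr ⟨z 0, hz.1, (hval z hz).symm⟩
      · rintro (rfl | ⟨a, ha, rfl⟩)
        · exact ⟨0, mem_insert _ _, by simp⟩
        -- Every `a` in `A` is the first coordinate of a point of the product; the other coordinates
        -- may be `0`.
        · have hz : (Fin.cons a fun _ => 0 : Fin (m + 1) → ℝ) ∈ prodCube m A :=
            ⟨by simpa using ha, fun j => by simp⟩
          exact ⟨_, Or.inr ⟨_, hz, rfl⟩, by rw [hval _ hz]; simp⟩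
    rw [hset, dimH_insert, dimH_image_add_continuousLinearEquiv _ hc,
      dimH_eq_of_isRegularCompact hα.1 hA]
    push_cast
    congr 1
    ring
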